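/- **Setting.** In an \((L,K,M,N)\) multi-user information retrieval (MIR) system there are \(N\) files, a base station (BS) with \(L\) antennas and no access to the files, and \(K\) single-antenna users with a memory of \(M\) files each. An *\(F\)-division \((L,K,M,N)\) MIR coded caching scheme* consists of the following. Every file \(n\) is divided into \(F\) packets \(W_{n,1},\dots,W_{n,F}\) (represented by their coded packets, vectors of complex symbols), and every user caches a set of at most \(MF\) packets, chosen independently of demands and channels. Given the demand vector \(d\in[N]^K\) and the channels, there are \(S_{\rm UL}\) uplink transmissions: in transmission \(s\) each user sends a linear combination of requested packets that it caches, so the users send \(V^{(s)}W\), and the BS receives \(y^{(s)}=H^{(s)}V^{(s)}W\) with \(H^{(s)}\in\mathbb C^{L\times K}\). Then there are \(S_{\rm DL}\) downlink transmissions: in transmission \(s'\) the users receive \(D^{(s')}U^{(s')}\,(y^{(1)};\dots;y^{(S_{\rm UL})})\) with \(D^{(s')}\in\mathbb C^{K\times L}\). (Noise is neglected, as the power \(P\) tends to infinity.) For all demands and all channel matrices \(H^{(s)},D^{(s')}\) of which every submatrix has full rank (which holds almost surely for channel entries with a joint density), every user can recover its demanded file from its cached packets and its received signals. Each transmission carries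 packets coded at rate \(\log P+o(\log P)\) bits per time slot. The normalized delivery times (NDTs) \(\tau_{\rm UL},\tau_{\rm DL}\) are the limits, as first the file size \(B_0\) and then \(P\) tends to infinity, of the numbers of time slots of the uplink and of the downlink divided by \(B_0/\log P\). The sum-DoF is the number of demanded packets not cached by the users demanding them (summed over the users), divided by the number of transmissions. **Theorem 3.** Let \(K,L,t,N\) be positive integers with \(t<L\). Let \(F\) be one of the following: 1. \(F=\beta\binom{K/m}{t/m}\), where \(t<K/2\), \(m\) is a positive integer with \(m\mid K\), \(m\mid t\) (so \(m\le t\)), \(l=\frac{m}{\gcd(m,t-m)}\), \(\beta=\bigl(\operatorname{sgn}(\tfrac tm+1,\tfrac mt)+\tfrac{t-m}{m}\bigr)l\), and \(\operatorname{sgn}(x,y)\) is \(1\) if \(y=1\) and \(x\) otherwise; 2. \(F=\frac{2t}{\alpha}\binom{K/\alpha}{2t/\alpha}\), where \(t\le K/2\) and \(\alpha=\gcd(K,t)\); 3. \(F=K\), where \(t=K/2\). Then, with \(Z=tF/K\), which is an integer, and \(M=\frac{ZN}{F}\), there exists an \(F\)-division \((L,K,M,N)\) MIR coded caching scheme in which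 every user caches exactly \(Z\) packets of every file and the BS uses only \(t\) of its antennas (the other \(L-t\) are silent), which has sum-DoF \(2t\) in the uplink and in the downlink for every demand vector, and the NDTs \[\tau_{\rm UL}=\tau_{\rm DL}=\frac{K-t}{2t}.\] -/

import Mathlib

noncomputable section

namespace MIR

open Filter Topology Asymptotics MeasureTheory

/-! ### Channels -/

/-- Every submatrix of `A` has full rank, i.e. all square submatrices are nonsingular. -/
def SubmatricesFullRank {m n : Type*} (A : Matrix m n ℂ) : Prop :=
  ∀ (r : ℕ) (i : Fin r ↪ m) (j : Fin r ↪ n), (A.submatrix i j).det ≠ 0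

/-- Lebesgue-almost every matrix satisfies the full rank condition, so that it holds almost surely
for random channel matrices with a density, e.g. with i.i.d. complex Gaussian entries. -/
theorem ae_submatricesFullRank (m n : ℕ) :
    ∀ᵐ A : Fin m → Fin n → ℂ, SubmatricesFullRank (Matrix.of A) := by
  unfold SubmatricesFullRank
  rw [ae_all_iff]; intro r
  rw [ae_all_iff]; intro i
  rw [ae_all_iff]; intro j
  classical
  let A₀ : Fin m → Fin n → ℂ := fun a b => if ∃ k, i k = a ∧ j k = b then 1 else 0
  let T : ℂ →ₗ[ℝ] (Fin m → Fin n → ℂ) :=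
    (LinearMap.toSpanSingleton ℂ (Fin m → Fin n → ℂ) A₀).restrictScalars ℝ
  have hA₀ : (Matrix.of A₀).submatrix i j = 1 := by
    ext a b
    simp only [A₀, Matrix.submatrix_apply, Matrix.of_apply, Matrix.one_apply]
    congr 1
    simp
  have hcont : Continuous fun A : Fin m → Fin n → ℂ => ((Matrix.of A).submatrix i j).det := by
    apply Continuous.matrix_det
    apply continuous_matrix
    intro a b
    exact (continuous_apply (j b)).comp (continuous_apply (i a))
  have : (volume : Measure (Fin m → Fin n → ℂ)).IsAddHaarMeasure :=
    Measure.pi.isAddHaarMeasure (α := fun _ : Fin m => Fin n → ℂ) (fun _ => volume)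
  refine ae_mem_of_ae_add_linearMap_mem
    (s := {A : Fin m → Fin n → ℂ | ((Matrix.of A).submatrix i j).det ≠ 0}) T volume volume ?_ ?_
  · exact (isOpen_ne_fun hcont continuous_const).measurableSet
  · intro A
    have hfin : {x : ℂ | (Matrix.charpoly (-((Matrix.of A).submatrix i j))).eval x = 0}.Finite :=
      Polynomial.finite_setOfPred_isRoot (Matrix.charpoly_monic _).ne_zero
    have hnull := hfin.measure_zero (volume : Measure ℂ)
    refine (measure_eq_zero_iff_ae_notMem.1 hnull).mono fun x hx => ?_
    intro h0
    apply hx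
    have hmat : (Matrix.of (A + T x)).submatrix i j
        = Matrix.scalar (Fin r) x - -((Matrix.of A).submatrix i j) := by
      have : (Matrix.of (A + T x)).submatrix i j
          = (Matrix.of A).submatrix i j + x • (Matrix.of A₀).submatrix i j := by
        ext a b; simp [T]
      rw [this, hA₀, Matrix.scalar_apply, ← Matrix.smul_one_eq_diagonal, sub_neg_eq_add, add_comm]
    rw [hmat] at h0
    simpa [Matrix.eval_charpoly] using h0

/-- The channel matrices of all uplink transmissions (`L × K`) and of all downlink transmissions
(`K × L`). The downlink matrices may, but need not, be the conjugate transposes of the uplink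
ones. -/
structure Channel (L K SUL SDL : ℕ) where
  up : Fin SUL → Matrix (Fin L) (Fin K) ℂ
  down : Fin SDL → Matrix (Fin K) (Fin L) ℂ

/-- All submatrices of all channel matrices have full rank. -/
def Channel.FullRank {L K SUL SDL : ℕ} (c : Channel L K SUL SDL) : Prop :=
  (∀ s, SubmatricesFullRank (c.up s)) ∧ ∀ s', SubmatricesFullRank (c.down s')

/-! ### Signals (noise free); `W` holds the coded packets, each consisting of `b` symbols -/

/-- The signals received by the `L` antennas of the base station in one uplink transmission:
the users send `V * W` over the channel `H`. -/
def bsSignal {L K N F b : ℕ} (H : Matrix (Fin L) (Fin K) ℂ)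
    (V : Matrix (Fin K) (Fin N × Fin F) ℂ) (W : Matrix (Fin N × Fin F) (Fin b) ℂ) :
    Matrix (Fin L) (Fin b) ℂ :=
  H * (V * W)

/-- All signals received by the base station, stacked. -/
def bsStack {L K N F b SUL : ℕ} (H : Fin SUL → Matrix (Fin L) (Fin K) ℂ)
    (V : Fin SUL → Matrix (Fin K) (Fin N × Fin F) ℂ) (W : Matrix (Fin N × Fin F) (Fin b) ℂ) :
    Matrix (Fin SUL × Fin L) (Fin b) ℂ :=
  Matrix.of fun i => bsSignal (H i.1) (V i.1) W i.2

/-- The signals received by the `K` users in one downlink transmission with channel `D`, when the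
base station applies the precoding matrix `U` to its stacked received signals `Y`. -/
def userSignal {L K b SUL : ℕ} (D : Matrix (Fin K) (Fin L) ℂ)
    (U : Matrix (Fin L) (Fin SUL × Fin L) ℂ) (Y : Matrix (Fin SUL × Fin L) (Fin b) ℂ) :
    Matrix (Fin K) (Fin b) ℂ :=
  D * (U * Y)

/-! ### Schemes -/

/-- An `F`-division `(L, K, M, N)` MIR coded caching scheme: `L` antennas, `K` users with a memory
of `M` files each, `N` files of `F` packets; the pair `(n, f)` stands for packet `f` of file `n`.
The placement depends neither on the demands nor on the channels, the precoding matrices may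
depend on both. -/
structure Scheme (L K : ℕ) (M : ℝ) (N F : ℕ) where
  /-- the packets that a user caches (uncoded placement) -/
  cache : Fin K → Finset (Fin N × Fin F)
  cache_card_le : ∀ k, ((cache k).card : ℝ) ≤ M * F
  /-- number of uplink transmissions -/
  SUL : ℕ
  /-- number of downlink transmissions -/
  SDL : ℕ
  /-- uplink precoding matrices -/
  V : (Fin K → Fin N) → Channel L K SUL SDL → Fin SUL → Matrix (Fin K) (Fin N × Fin F) ℂ
  /-- a user sends linear combinations of requested packets that it caches -/
  V_support : ∀ d c s k p, V d c s k p ≠ 0 → p ∈ cache k ∧ ∃ k', d k' = p.1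
  /-- downlink precoding matrices -/
  U : (Fin K → Fin N) → Channel L K SUL SDL → Fin SDL → Matrix (Fin L) (Fin SUL × Fin L) ℂ
  /-- every user recovers all packets of the file it demands from its cached packets and the
  signals it receives -/
  decodable : ∀ (d : Fin K → Fin N) (c : Channel L K SUL SDL), c.FullRank →
    ∀ (b : ℕ) (k : Fin K),
      ∃ dec : (cache k → Fin b → ℂ) → (Fin SDL → Fin b → ℂ) → (Fin F → Fin b → ℂ),
        ∀ W : Matrix (Fin N × Fin F) (Fin b) ℂ,
          dec (fun p => W p)
              (fun s' => userSignal (c.down s') (U d c s') (bsStack c.up (V d c) W) k)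
            = fun f => W (d k, f)

/-- The scheme uses only the antennas in `A`: the other antennas are silent in the downlink, and
what they receive in the uplink is discarded. -/
def Scheme.UsesOnlyAntennas {L K : ℕ} {M : ℝ} {N F : ℕ} (σ : Scheme L K M N F)
    (A : Finset (Fin L)) : Prop :=
  ∀ d c s' l s j, (l ∉ A ∨ j ∉ A) → σ.U d c s' l (s, j) = 0

/-- Number of packets which have to be delivered to the users for the demand vector `d`: those of
the demanded files that the respective users do not cache. -/
def Scheme.requiredPackets {L K : ℕ} {M : ℝ} {N F : ℕ} (σ : Scheme L K M N F)
    (d : Fin K → Fin N) : ℕ :=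
  ∑ k, (Finset.univ.filter fun f : Fin F => (d k, f) ∉ σ.cache k).card

/-- The sum-DoF of the uplink: required packets delivered per uplink transmission. -/
def Scheme.sumDoFUL {L K : ℕ} {M : ℝ} {N F : ℕ} (σ : Scheme L K M N F)
    (d : Fin K → Fin N) : ℝ :=
  (σ.requiredPackets d : ℝ) / σ.SUL

/-- The sum-DoF of the downlink: required packets delivered per downlink transmission. -/
def Scheme.sumDoFDL {L K : ℕ} {M : ℝ} {N F : ℕ} (σ : Scheme L K M N F)
    (d : Fin K → Fin N) : ℝ :=
  (σ.requiredPackets d : ℝ) / σ.SDL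

/-- `τ` is the normalized delivery time of a communication step of `S` transmissions (for every
demand vector), each packet being an `F`-th part of a file. At power `P` and file size `V` bits, a
packet of `V / F` bits is coded into `b P V` complex symbols, at a rate that equals
`log P + o(log P)` in the limit `V → ∞`, so that the step takes `S * b P V` time slots. The
normalized delivery time is the limit of `S * b P V / (V / log P)` as first `V → ∞` and then
`P → ∞`. -/
def IsNDT (S F : ℕ) (τ : ℝ) : Prop :=
  ∀ (rate : ℝ → ℝ) (b : ℝ → ℝ → ℕ),
    (fun P => rate P - Real.log P) =o[atTop] Real.log →
    (∀ᶠ P in atTop, Tendsto (fun V : ℝ => (V / F) / b P V) atTop (𝓝 (rate P))) →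
    ∃ g : ℝ → ℝ,
      (∀ᶠ P in atTop,
        Tendsto (fun V : ℝ => ((S : ℝ) * b P V) / (V / Real.log P)) atTop (𝓝 (g P))) ∧
      Tendsto g atTop (𝓝 τ)

/-! ### The list of schemes -/

/-- `sgn(x, y)` equals `1` if `y = 1`, and `x` otherwise. -/
def sgn (x : ℕ) (y : ℚ) : ℕ := if y = 1 then 1 else x

/-- `β = (sgn(t/m + 1, m/t) + (t - m)/m) * l` with `l = m / gcd(m, t - m)`; used for `m ∣ t` and
`0 < m ≤ t`, when all quotients are exact. -/
def beta (t m : ℕ) : ℕ :=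
  (sgn (t / m + 1) ((m : ℚ) / t) + (t - m) / m) * (m / Nat.gcd m (t - m))

/-- `Listed K t F`: the table of schemes for `K` users and the parameter `t` has an entry with
subpacketization `F`. -/
inductive Listed (K t : ℕ) : ℕ → Prop
  | scheme1 (m : ℕ) (hm : 0 < m) (hmK : m ∣ K) (hmt : m ∣ t) (hle : m ≤ t) (htK : 2 * t < K) :
      Listed K t (beta t m * Nat.choose (K / m) (t / m))
  | scheme2 (htK : 2 * t ≤ K) :
      Listed K t
        (2 * t / Nat.gcd K t * Nat.choose (K / Nat.gcd K t) (2 * t / Nat.gcd K t))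
  | scheme3 (htK : 2 * t = K) : Listed K t K

end MIR

end

noncomputable section

namespace MIR

open Finset Filter Topology Asymptotics Matrix

/-! The problem splits into linear algebra for one group of `2 * t` users and a combinatorial design
that arranges all deliveries into such groups.

Within a group, the packet meant for user `k` is cached by `t` members of the group and missing at
the other `t`, one of which is `k`. Its holders send it jointly and the BS merely repeats what `t`
antennas heard. From the holders to the other members this is a product of two nonsingular `t × t`
submatrices of the channels, so the packet can be made to arrive at `k` with coefficient 1 and to
vanish at the other members lacking it (`exists_beam`). The holders subtract it. Hence all `2 * t`
packets of a group share one uplink and one downlink transmission (`DeliveryDesign.decodes`).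

If each missing pair (user, packet) is served exactly once, double counting gives `2 * t * n = F *
(K - t)` for the number `n` of groups (`DeliveryDesign.card_group_mul`), whence the sum-DoF and the
NDTs.

Designs come from three base families: `nonempty_design_pairs`, `nonempty_design_subsets` and
`nonempty_design_pointed`. Two operations adapt them to the table: replacing each user by several,
and splitting packets that are served `μ` times into `μ` copies. -/

/-- A combinatorial delivery design: packet `p` is cached by the `t` users in `T p`, and the group
`g` delivers to each user `k` of the `2 * t` users in `S g` the packet `a g k`. -/
structure DeliveryDesign (U P G : Type) [Fintype U] [Fintype P] [Fintype G] (t μ : ℕ) where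
  T : P → Finset U
  S : G → Finset U
  a : G → U → P
  z : ℕ
  card_T : ∀ p, (T p).card = t
  card_S : ∀ g, (S g).card = 2 * t
  subset : ∀ g, ∀ k ∈ S g, T (a g k) ⊆ S g
  notMem : ∀ g, ∀ k ∈ S g, k ∉ T (a g k)
  served : ∀ k p, k ∉ T p → Nat.card {g // k ∈ S g ∧ a g k = p} = μ
  regular : ∀ k, Nat.card {p // k ∈ T p} = z

/-! ### Operations on designs and double counting -/

namespace DeliveryDesign

variable {U P G : Type} [Fintype U] [Fintype P] [Fintype G] {t μ : ℕ}

/-- Replace every user by `m` users. -/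
def blowUp (δ : DeliveryDesign U P G t μ) (m : ℕ) :
    DeliveryDesign (U × Fin m) P G (t * m) μ where
  T p := δ.T p ×ˢ univ
  S g := δ.S g ×ˢ univ
  a g k := δ.a g k.1
  z := δ.z
  card_T p := by simp [δ.card_T]
  card_S g := by simp [δ.card_S, mul_assoc]
  subset g k hk := Finset.product_subset_product_left (δ.subset g k.1 (by simpa using hk))
  notMem g k hk := by simpa using δ.notMem g k.1 (by simpa using hk)
  served k p hk := by simpa using δ.served k.1 p (by simpa using hk)
  regular k := by simpa using δ.regular k.1

/-- Repeat every group `c` times. -/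
def replicate (δ : DeliveryDesign U P G t μ) (c : ℕ) :
    DeliveryDesign U P (G × Fin c) t (μ * c) where
  T := δ.T
  S g := δ.S g.1
  a g := δ.a g.1
  z := δ.z
  card_T := δ.card_T
  card_S g := δ.card_S g.1
  subset g := δ.subset g.1
  notMem g := δ.notMem g.1
  served k p hk := by
    rw [Nat.card_congr (Equiv.prodSubtypeFstEquivSubtypeProd
      (p := fun g => k ∈ δ.S g ∧ δ.a g k = p)), Nat.card_prod, δ.served k p hk, Nat.card_fin]
  regular := δ.regular

/-- For each user `k` lacking `p`, number the `μ` groups that serve `p` to `k`, and let the `i`-th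
of them deliver copy `i`. The numberings for different users need not be related. -/
theorem nonempty_unfold (δ : DeliveryDesign U P G t μ) (hμ : 0 < μ) :
    Nonempty (DeliveryDesign U (P × Fin μ) G t 1) := by
  classical
  have h : ∀ k p, k ∉ δ.T p → Nonempty ({g // k ∈ δ.S g ∧ δ.a g k = p} ≃ Fin μ) := fun k p hk =>
    ⟨Finite.equivFinOfCardEq (δ.served k p hk)⟩
  let e k p hk := (h k p hk).some
  let a' : G → U → P × Fin μ := fun g k =>
    -- The copy 0 is a dummy: users outside the group are not served.
    (δ.a g k, if hk : k ∈ δ.S g then e k _ (δ.notMem g k hk) ⟨g, hk, rfl⟩ else ⟨0, hμ⟩)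
  refine ⟨⟨fun p => δ.T p.1, δ.S, a', δ.z * μ, fun p => δ.card_T p.1, δ.card_S,
    δ.subset, δ.notMem, ?_, fun k => ?_⟩⟩
  · rintro k ⟨p, i⟩ hk
    have key : ∀ g, (k ∈ δ.S g ∧ a' g k = (p, i)) ↔ g = ((e k p hk).symm i).1 := by
      intro g
      constructor
      · rintro ⟨hg, h2⟩
        obtain ⟨rfl, h3⟩ := Prod.mk.inj h2
        rw [dif_pos hg] at h3
        rw [← h3, Equiv.symm_apply_apply]
      · rintro rfl
        have hj := (e k p hk).apply_symm_apply i
        generalize (e k p hk).symm i = q at hj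
        obtain ⟨g, hg, rfl⟩ := q
        exact ⟨hg, Prod.ext rfl ((dif_pos hg).trans hj)⟩
    simp [key]
  · rw [Nat.card_congr (Equiv.prodSubtypeFstEquivSubtypeProd (p := fun p => k ∈ δ.T p)),
      Nat.card_prod, δ.regular, Nat.card_fin]

theorem card_user_mul (δ : DeliveryDesign U P G t μ) :
    Fintype.card U * δ.z = t * Fintype.card P := by
  have e : (Σ k : U, {p // k ∈ δ.T p}) ≃ Σ p : P, {k // k ∈ δ.T p} :=
    { toFun := fun x => ⟨x.2.1, x.1, x.2.2⟩
      invFun := fun x => ⟨x.2.1, x.1, x.2.2⟩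
      left_inv := fun _ => rfl
      right_inv := fun _ => rfl }
  have := Nat.card_congr e
  rw [Nat.card_sigma, Nat.card_sigma] at this
  simpa [δ.regular, δ.card_T, mul_comm t] using this

/-- The pairs of a group and a member are fibred over the pairs of a packet and a user lacking it;
each fibre has `μ` elements. -/
theorem card_group_mul (δ : DeliveryDesign U P G t μ) :
    2 * t * Fintype.card G = Fintype.card P * (Fintype.card U - t) * μ := by
  have e : (Σ g : G, {k // k ∈ δ.S g}) ≃
      Σ y : (Σ p : P, {k // k ∉ δ.T p}), {g // y.2.1 ∈ δ.S g ∧ δ.a g y.2.1 = y.1} :=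
    { toFun := fun x => ⟨⟨δ.a x.1 x.2.1, x.2.1, δ.notMem _ _ x.2.2⟩, x.1, x.2.2, rfl⟩
      invFun := fun x => ⟨x.2.1, x.1.2.1, x.2.2.1⟩
      left_inv := fun _ => rfl
      right_inv := by rintro ⟨⟨p, k, hk⟩, g, hg, h⟩; dsimp only at h; subst h; rfl }
  have := Nat.card_congr e
  classical
  rw [Nat.card_sigma, Nat.card_sigma] at this
  rw [Finset.sum_congr rfl fun (y : Σ p : P, {k // k ∉ δ.T p}) _ =>
    δ.served y.2.1 y.1 y.2.2] at this
  simp [δ.card_S, Fintype.card_subtype_compl, δ.card_T] at this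
  rw [mul_comm, this]

/-- Rename users, packets and groups. -/
def reindex (δ : DeliveryDesign U P G t μ) {U' P' G' : Type} [Fintype U'] [Fintype P'] [Fintype G']
    (u : U' ≃ U) (v : P' ≃ P) (w : G' ≃ G) : DeliveryDesign U' P' G' t μ where
  T p := (δ.T (v p)).map u.symm.toEmbedding
  S g := (δ.S (w g)).map u.symm.toEmbedding
  a g k := v.symm (δ.a (w g) (u k))
  z := δ.z
  card_T p := by simp [δ.card_T]
  card_S g := by simp [δ.card_S]
  subset g k hk := by
    simpa using δ.subset (w g) (u k) (by simpa [Finset.mem_map_equiv] using hk)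
  notMem g k hk := by
    simpa [Finset.mem_map_equiv] using
      δ.notMem (w g) (u k) (by simpa [Finset.mem_map_equiv] using hk)
  served k p hk := by
    refine Eq.trans ?_ (δ.served (u k) (v p) (by simpa [Finset.mem_map_equiv] using hk))
    refine Nat.card_congr (w.subtypeEquiv fun g => ?_)
    simp [Finset.mem_map_equiv, Equiv.symm_apply_eq]
  regular k := by
    rw [← δ.regular (u k)]
    refine Nat.card_congr (v.subtypeEquiv fun g => ?_)
    simp [Finset.mem_map_equiv]

end DeliveryDesign

/-- Existence of a delivery design for `K` users and `F` packets. -/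
def HasDesign (K t F : ℕ) : Prop :=
  ∃ S, Nonempty (DeliveryDesign (Fin K) (Fin F) (Fin S) t 1)

theorem DeliveryDesign.hasDesign {U P G : Type} [Fintype U] [Fintype P] [Fintype G] {t μ : ℕ}
    (δ : DeliveryDesign U P G t μ) (hμ : 0 < μ) (m : ℕ) :
    HasDesign (Fintype.card U * m) (t * m) (Fintype.card P * μ) := by
  obtain ⟨ε⟩ := (δ.blowUp m).nonempty_unfold hμ
  exact ⟨_, ⟨ε.reindex (Fintype.equivFinOfCardEq (by simp)).symm
    (Fintype.equivFinOfCardEq (by simp)).symm (Fintype.equivFin G).symm⟩⟩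

/-! ### Regular digraphs -/

/-- The circulant digraph with edges from `i` to `i + 1, …, i + r` works: for `r < n` these are
distinct and differ from `i`. -/
theorem exists_regular_digraph_zmod (n r : ℕ) (h : r < n) :
    ∃ N : ZMod n → ZMod n → Prop, (∀ i, ¬ N i i) ∧ (∀ i, Nat.card {k // N i k} = r) ∧
      ∀ k, Nat.card {i // N i k} = r := by
  have : NeZero n := ⟨by omega⟩
  have hc : Nat.card {d : ZMod n // d.val ∈ Finset.Icc 1 r} = r := by
    have e : {d : ZMod n // d.val ∈ Finset.Icc 1 r} ≃ Finset.Icc 1 r :=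
      { toFun := fun d => ⟨d.1.val, d.2⟩
        invFun := fun j => ⟨(j.1 : ZMod n), by
          rw [ZMod.val_natCast_of_lt ((Finset.mem_Icc.1 j.2).2.trans_lt h)]; exact j.2⟩
        left_inv := fun d => Subtype.ext (ZMod.natCast_zmod_val d.1)
        right_inv := fun j =>
          Subtype.ext (ZMod.val_natCast_of_lt ((Finset.mem_Icc.1 j.2).2.trans_lt h)) }
    rw [Nat.card_congr e, Nat.card_eq_fintype_card, Fintype.card_coe, Nat.card_Icc,
      Nat.add_sub_cancel]
  refine ⟨fun i k => (k - i).val ∈ Finset.Icc 1 r, fun i => by simp, fun i => ?_, fun k => ?_⟩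
  · exact (Nat.card_congr ((Equiv.subRight i).subtypeEquiv fun _ => Iff.rfl)).trans hc
  · exact (Nat.card_congr ((Equiv.subLeft k).subtypeEquiv fun _ => Iff.rfl)).trans hc

theorem exists_regular_digraph {U : Type} (R : Finset U) (r : ℕ) (h : r < R.card) :
    ∃ N : U → Finset U, (∀ i ∈ R, N i ⊆ R ∧ i ∉ N i ∧ (N i).card = r) ∧
      ∀ k ∈ R, Nat.card {i // i ∈ R ∧ k ∈ N i} = r := by
  classical
  obtain ⟨N, h1, h2, h3⟩ := exists_regular_digraph_zmod R.card r h
  have : NeZero R.card := ⟨by omega⟩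
  let e : R ≃ ZMod R.card := Fintype.equivOfCardEq (by simp)
  refine ⟨fun i => R.filter fun k => ∃ (hi : i ∈ R) (hk : k ∈ R), N (e ⟨i, hi⟩) (e ⟨k, hk⟩),
    fun i hi => ⟨Finset.filter_subset _ _, by simp [hi, h1], ?_⟩, fun k hk => ?_⟩
  · rw [← h2 (e ⟨i, hi⟩), ← Fintype.card_coe, ← Nat.card_eq_fintype_card]
    let f : {k // k ∈ R.filter fun k =>
        ∃ (hi : i ∈ R) (hk : k ∈ R), N (e ⟨i, hi⟩) (e ⟨k, hk⟩)} ≃ {k : R // N (e ⟨i, hi⟩) (e k)} :=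
      { toFun := fun k => ⟨⟨k, (Finset.mem_filter.1 k.2).1⟩, by
          obtain ⟨_, _, h⟩ := (Finset.mem_filter.1 k.2).2
          exact h⟩
        invFun := fun k => ⟨k.1, Finset.mem_filter.2 ⟨k.1.2, hi, k.1.2, k.2⟩⟩
        left_inv := fun _ => rfl
        right_inv := fun _ => rfl }
    exact (Nat.card_congr f).trans (Nat.card_congr (e.subtypeEquiv fun _ => Iff.rfl))
  · rw [← h3 (e ⟨k, hk⟩)]
    let f : {i // i ∈ R ∧ k ∈ R.filter fun k =>
        ∃ (hi : i ∈ R) (hk : k ∈ R), N (e ⟨i, hi⟩) (e ⟨k, hk⟩)} ≃ {i : R // N (e i) (e ⟨k, hk⟩)} :=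
      { toFun := fun i => ⟨⟨i, i.2.1⟩, by simpa [hk, i.2.1] using i.2.2⟩
        invFun := fun i => ⟨i.1, i.1.2, by simpa [hk] using i.2⟩
        left_inv := fun _ => rfl
        right_inv := fun _ => rfl }
    exact (Nat.card_congr f).trans (Nat.card_congr (e.subtypeEquiv fun _ => Iff.rfl))

/-! ### The base designs -/

/-- Every user holds one packet of its own, and any two users swap theirs. The general subset design
would serve every packet twice for subsets of size 1, doubling the subpacketization. -/
theorem nonempty_design_pairs (n : ℕ) :
    Nonempty (DeliveryDesign (Fin n) (Fin n) {x : Fin n × Fin n // x.1 < x.2} 1 1) := by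
  refine ⟨⟨fun p => {p}, fun x => {x.1.1, x.1.2}, fun x k => if k = x.1.1 then x.1.2 else x.1.1, 1,
    fun p => Finset.card_singleton p, fun x => Finset.card_pair x.2.ne, fun x k hk => ?_,
    fun x k hk => ?_, fun k p hk => ?_, fun k => ?_⟩⟩
  · split_ifs <;> simp
  · have := x.2
    simp only [Finset.mem_insert, Finset.mem_singleton] at hk ⊢
    split_ifs <;> grind
  · rw [Finset.mem_singleton] at hk
    refine Nat.card_eq_one_iff_exists.2 ⟨⟨⟨(min k p, max k p), min_lt_max.2 hk⟩, ?_⟩, ?_⟩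
    · simp only [Finset.mem_insert, Finset.mem_singleton]
      grind
    · rintro ⟨⟨⟨x, y⟩, hxy⟩, hk', h⟩
      simp only [Finset.mem_insert, Finset.mem_singleton] at hk' h hxy
      simp only [Subtype.mk.injEq, Prod.mk.injEq]
      grind
  · simp

theorem card_finset_mem (n r : ℕ) (k k' : Fin n) :
    Nat.card {s : Finset (Fin n) // s.card = r ∧ k ∈ s}
      = Nat.card {s : Finset (Fin n) // s.card = r ∧ k' ∈ s} := by
  refine Nat.card_congr ((Equiv.swap k k').finsetCongr.subtypeEquiv fun s => ?_)
  simp [Finset.mem_map_equiv]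

theorem natCard_mem_and {U : Type} (R : Finset U) (q : U → Prop) [DecidablePred q] :
    Nat.card {i // i ∈ R ∧ q i} = (R.filter q).card :=
  Nat.subtype_card _ fun _ => Finset.mem_filter

/-- All `τ`-subsets of the users, each with multiplicity `2 * τ`. The group of a `τ`-subset `s` and
a user `b ∉ s` delivers to each user in `B = s ∪ {b}` the packet of the other users in `B`, and the
packet of `s` to `τ - 1` users outside `B`. -/
theorem nonempty_design_subsets (n τ : ℕ) (hτ : 0 < τ) (h : 2 * τ ≤ n) :
    Nonempty (DeliveryDesign (Fin n) {s : Finset (Fin n) // s.card = τ}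
      {x : Finset (Fin n) × Fin n // x.1.card = τ ∧ x.2 ∉ x.1} τ (2 * τ)) := by
  choose C hC hC' using fun s : {s : Finset (Fin n) // s.card = τ} =>
    -- Degree `τ - 1` brings the group to `(τ + 1) + (τ - 1) = 2 * τ` users; the complement is large
    -- enough because `2 * τ ≤ n`.
    exists_regular_digraph s.1ᶜ (τ - 1) (by rw [Finset.card_compl, s.2, Fintype.card_fin]; omega)
  have hB : ∀ (s : Finset (Fin n)) (b k : Fin n), s.card = τ → b ∉ s → k ∈ insert b s →
      ((insert b s).erase k).card = τ := by
    intro s b k hs hb hk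
    rw [Finset.card_erase_of_mem hk, Finset.card_insert_of_notMem hb, hs, Nat.add_sub_cancel]
  refine ⟨⟨Subtype.val, fun x => insert x.1.2 x.1.1 ∪ C ⟨x.1.1, x.2.1⟩ x.1.2,
    fun x k => if hk : k ∈ insert x.1.2 x.1.1 then
      ⟨(insert x.1.2 x.1.1).erase k, hB _ _ _ x.2.1 x.2.2 hk⟩ else ⟨x.1.1, x.2.1⟩,
    Nat.card {s : Finset (Fin n) // s.card = τ ∧ (⟨0, by omega⟩ : Fin n) ∈ s},
    Subtype.property, ?_, ?_, ?_, ?_, ?_⟩⟩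
  · rintro ⟨⟨s, b⟩, hs, hb⟩
    obtain ⟨h1, h2, h3⟩ := hC ⟨s, hs⟩ b (by simpa using hb)
    rw [Finset.card_union_of_disjoint, Finset.card_insert_of_notMem hb, h3]
    · dsimp only at hs ⊢
      omega
    · rw [Finset.disjoint_insert_left]
      exact ⟨h2, Finset.disjoint_left.2 fun k hk hk' => Finset.mem_compl.1 (h1 hk') hk⟩
  · rintro ⟨⟨s, b⟩, hs, hb⟩ k hk
    dsimp only at hk ⊢
    split_ifs
    · exact (Finset.erase_subset _ _).trans Finset.subset_union_left
    · exact (Finset.subset_insert _ _).trans Finset.subset_union_left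
  · rintro ⟨⟨s, b⟩, hs, hb⟩ k hk
    dsimp only at hk ⊢
    split_ifs with h1
    · exact Finset.notMem_erase _ _
    · exact fun h2 => h1 (Finset.mem_insert_of_mem h2)
  · rintro k p hk
    -- A user `k` outside `p` gets `p` in two ways: with `B = p ∪ {k}` and any `b ∈ B`, in `τ + 1`
    -- groups, or with `s = p` and `k` an out-neighbour of `b`, in `τ - 1` groups.
    have hcard : Nat.card ({b // b ∈ insert k p.1} ⊕ {b // b ∈ p.1ᶜ ∧ k ∈ C p b}) = 2 * τ := by
      rw [Nat.card_sum, hC' p k (Finset.mem_compl.2 hk), Nat.card_eq_fintype_card,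
        Fintype.card_coe, Finset.card_insert_of_notMem hk, p.2]
      omega
    rw [← hcard]
    symm
    have e1 : ∀ b ∈ insert k p.1, insert b ((insert k p.1).erase b) = insert k p.1 :=
      fun b hb => Finset.insert_erase hb
    have hkk : k ∈ insert k p.1 := Finset.mem_insert_self _ _
    refine Nat.card_eq_of_bijective (Sum.elim
      (fun b => ⟨⟨((insert k p.1).erase b.1, b.1), hB _ _ _ p.2 hk b.2, Finset.notMem_erase _ _⟩,
        ?_⟩)
      (fun b => ⟨⟨(p.1, b.1), p.2, Finset.mem_compl.1 b.2.1⟩, ?_⟩)) ⟨?_, ?_⟩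
    · dsimp only
      refine ⟨Finset.mem_union_left _ (by rw [e1 _ b.2]; exact hkk), ?_⟩
      rw [dif_pos (by rw [e1 _ b.2]; exact hkk)]
      refine Subtype.ext ?_
      dsimp only
      rw [e1 _ b.2, Finset.erase_insert hk]
    · dsimp only
      refine ⟨Finset.mem_union_right _ b.2.2, dif_neg ?_⟩
      rw [Finset.mem_insert, not_or]
      refine ⟨?_, hk⟩
      intro hkb
      exact (hC p b b.2.1).2.1 (hkb ▸ b.2.2)
    · rintro (⟨b, hb⟩ | ⟨b, hb⟩) (⟨c, hc⟩ | ⟨c, hc⟩) hbc <;>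
        simp only [Sum.elim_inl, Sum.elim_inr, Subtype.mk.injEq, Prod.mk.injEq] at hbc <;>
        obtain ⟨h1, rfl⟩ := hbc
      · rfl
      · exfalso
        have : k = b := by
          by_contra hne
          exact hk (h1 ▸ Finset.mem_erase.2 ⟨hne, hkk⟩)
        subst this
        exact (hC p k hc.1).2.1 hc.2
      · exfalso
        have : k = b := by
          by_contra hne
          exact hk (h1.symm ▸ Finset.mem_erase.2 ⟨hne, hkk⟩)
        subst this
        exact (hC p k hb.1).2.1 hb.2
      · rfl
    · rintro ⟨⟨⟨s, b⟩, hs, hb⟩, hkS, hp⟩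
      dsimp only at hs hb hkS hp
      split_ifs at hp with hkB
      · subst hp
        have e2 : insert k ((insert b s).erase k) = insert b s := Finset.insert_erase hkB
        refine ⟨Sum.inl ⟨b, by dsimp only; rw [e2]; exact Finset.mem_insert_self _ _⟩, ?_⟩
        simp only [Sum.elim_inl, Subtype.mk.injEq, Prod.mk.injEq, and_true]
        rw [e2, Finset.erase_insert hb]
      · subst hp
        refine ⟨Sum.inr ⟨b, Finset.mem_compl.2 hb, ?_⟩, rfl⟩
        exact (Finset.mem_union.1 hkS).resolve_left hkB
  · intro k
    rw [← card_finset_mem n τ k]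
    exact Nat.card_congr (Equiv.subtypeSubtypeEquivSubtypeInter _ fun s => k ∈ s)

theorem card_pointed_finset (n r : ℕ) :
    Fintype.card {x : Finset (Fin n) × Fin n // x.1.card = r ∧ x.2 ∈ x.1} = r * n.choose r := by
  let e : {x : Finset (Fin n) × Fin n // x.1.card = r ∧ x.2 ∈ x.1} ≃
      Σ s : {s : Finset (Fin n) // s.card = r}, {i // i ∈ s.1} :=
    { toFun := fun x => ⟨⟨x.1.1, x.2.1⟩, x.1.2, x.2.2⟩
      invFun := fun y => ⟨(y.1.1, y.2.1), y.1.2, y.2.2⟩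
      left_inv := fun _ => rfl
      right_inv := fun _ => rfl }
  rw [Fintype.card_congr e, Fintype.card_sigma]
  simp only [Fintype.card_coe]
  rw [Finset.sum_congr rfl fun (s : {s : Finset (Fin n) // s.card = r}) _ => s.2]
  simp [mul_comm]

/-- Packets `(s, i)` with `i ∈ s` and `|s| = 2 * τ`, cached by the out-neighbours of `i` in a regular
digraph on `s`. A user `k` receives the packet `(s, i)` in a group of the users `s` if `k ∈ s`, and
of the users `s ∪ {k} \ {i}` otherwise. -/
theorem nonempty_design_pointed (n τ : ℕ) (hτ : 0 < τ) (h : 2 * τ ≤ n) :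
    Nonempty (DeliveryDesign (Fin n) {x : Finset (Fin n) × Fin n // x.1.card = 2 * τ ∧ x.2 ∈ x.1}
      ({s : Finset (Fin n) // s.card = 2 * τ} × Fin (n - τ)) τ 1) := by
  choose N hN hN' using fun s : {s : Finset (Fin n) // s.card = 2 * τ} =>
    exists_regular_digraph s.1 τ (by rw [s.2]; omega)
  set P := {x : Finset (Fin n) × Fin n // x.1.card = 2 * τ ∧ x.2 ∈ x.1}
  let T : P → Finset (Fin n) := fun x => N ⟨x.1.1, x.2.1⟩ x.1.2
  have hT : ∀ x : P, T x ⊆ x.1.1 ∧ x.1.2 ∉ T x ∧ (T x).card = τ := fun x => hN _ _ x.2.2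
  let q : Fin n → P → Finset (Fin n) := fun k x =>
    if k ∈ x.1.1 then x.1.1 else insert k (x.1.1.erase x.1.2)
  have hq : ∀ k x, (q k x).card = 2 * τ := by
    intro k x
    simp only [q]
    split_ifs with hk
    · exact x.2.1
    · rw [Finset.card_insert_of_notMem (fun h => hk (Finset.mem_of_mem_erase h)),
        Finset.card_erase_of_mem x.2.2, x.2.1]
      omega
  have hkq : ∀ k x, k ∈ q k x := by
    intro k x
    simp only [q]
    split_ifs with hk
    · exact hk
    · exact Finset.mem_insert_self _ _
  have hTq : ∀ k x, T x ⊆ q k x := by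
    intro k x j hj
    simp only [q]
    split_ifs with hk
    · exact (hT x).1 hj
    · exact Finset.mem_insert_of_mem
        (Finset.mem_erase.2 ⟨fun h => (hT x).2.1 (h ▸ hj), (hT x).1 hj⟩)
  -- The packets that `k` needs and that are assigned to `s` are the `(s, i)` where `k` is not an
  -- out-neighbour of `i`, which number `2 * τ - τ`, and the `(s ∪ {x} \ {k}, x)` with `x ∉ s`,
  -- which number `n - 2 * τ`. The total `n - τ` does not depend on `k`, so `n - τ` groups on `s`
  -- suffice for all members at once.
  have hcount : ∀ (s : {s : Finset (Fin n) // s.card = 2 * τ}) (k : Fin n), k ∈ s.1 →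
      Nat.card {x : P // k ∉ T x ∧ q k x = s.1} = n - τ := by
    rintro ⟨s, hs⟩ k hk
    dsimp only at hk ⊢
    have hcard : Nat.card ({i // i ∈ s ∧ k ∉ N ⟨s, hs⟩ i} ⊕ {x // x ∈ sᶜ}) = n - τ := by
      have h1 := hN' ⟨s, hs⟩ k hk
      rw [natCard_mem_and] at h1
      have h2 := Finset.card_filter_add_card_filter_not (s := s) fun i => k ∈ N ⟨s, hs⟩ i
      dsimp only at h1
      rw [Nat.card_sum, natCard_mem_and, Nat.card_eq_fintype_card, Fintype.card_coe,
        Finset.card_compl, hs, Fintype.card_fin]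
      omega
    rw [← hcard]
    symm
    have hkx : ∀ x ∈ sᶜ, k ∉ insert x (s.erase k) := by
      intro x hx hkx
      rcases Finset.mem_insert.1 hkx with rfl | h1
      · exact Finset.mem_compl.1 hx hk
      · exact Finset.notMem_erase _ _ h1
    refine Nat.card_eq_of_bijective (Sum.elim
      (fun i => ⟨⟨(s, i.1), hs, i.2.1⟩, i.2.2, if_pos hk⟩)
      (fun x => ⟨⟨(insert x.1 (s.erase k), x.1), ?_, Finset.mem_insert_self _ _⟩,
        fun h1 => hkx _ x.2 ((hT _).1 h1), ?_⟩)) ⟨?_, ?_⟩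
    · rw [Finset.card_insert_of_notMem
        (fun h => Finset.mem_compl.1 x.2 (Finset.mem_of_mem_erase h)),
        Finset.card_erase_of_mem hk, hs]
      omega
    · simp only [q]
      rw [if_neg (hkx _ x.2), Finset.erase_insert
        (fun h => Finset.mem_compl.1 x.2 (Finset.mem_of_mem_erase h)), Finset.insert_erase hk]
    · rintro (⟨b, hb⟩ | ⟨b, hb⟩) (⟨c, hc⟩ | ⟨c, hc⟩) hbc <;>
        have h1 := congrArg (fun z => z.1.1.1) hbc <;>
        obtain rfl : b = c := congrArg (fun z => z.1.1.2) hbc <;>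
        dsimp only [Sum.elim_inl, Sum.elim_inr] at h1
      · rfl
      · exact absurd (h1 ▸ hk) (hkx _ hc)
      · exact absurd (h1.symm ▸ hk) (hkx _ hb)
      · rfl
    · rintro ⟨⟨⟨s', i⟩, hs', hi⟩, hkT, hqs⟩
      simp only [q] at hqs hs' hi
      split_ifs at hqs with hks
      · subst hqs
        exact ⟨Sum.inl ⟨i, hi, hkT⟩, rfl⟩
      · subst hqs
        have hki : i ≠ k := by rintro rfl; exact hks hi
        refine ⟨Sum.inr ⟨i, by simp [hki]⟩, ?_⟩
        refine Subtype.ext (Subtype.ext (Prod.ext ?_ rfl))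
        change insert i ((insert k (s'.erase i)).erase k) = s'
        rw [Finset.erase_insert (fun h => hks (Finset.mem_of_mem_erase h)), Finset.insert_erase hi]
  -- Each member may receive its packets in any order: the holders of every such packet lie in `s`,
  -- whatever the other members receive.
  let e := fun (s : {s : Finset (Fin n) // s.card = 2 * τ}) (k : Fin n) (hk : k ∈ s.1) =>
    (Finite.equivFinOfCardEq (hcount s k hk)).symm
  have hP : Nonempty P := by
    refine Fintype.card_pos_iff.1 ?_
    rw [card_pointed_finset]
    exact Nat.mul_pos (by omega) (Nat.choose_pos h)
  let a : {s : Finset (Fin n) // s.card = 2 * τ} × Fin (n - τ) → Fin n → P := fun g k =>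
    if hk : k ∈ g.1.1 then (e g.1 k hk g.2).1 else hP.some
  have ha : ∀ g k (hk : k ∈ g.1.1), a g k = (e g.1 k hk g.2).1 := fun g k hk => dif_pos hk
  refine ⟨⟨T, fun g => g.1.1, a,
    Nat.card {s : Finset (Fin n) // s.card = 2 * τ ∧ (⟨0, by omega⟩ : Fin n) ∈ s} * τ,
    fun x => (hT x).2.2, fun g => g.1.2, fun g k hk => ?_, fun g k hk => ?_, fun k p hk => ?_,
    fun k => ?_⟩⟩
  · rw [ha g k hk]
    exact (hTq k _).trans (e g.1 k hk g.2).2.2.subset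
  · rw [ha g k hk]
    exact (e g.1 k hk g.2).2.1
  · let y : {x : P // k ∉ T x ∧ q k x = q k p} := ⟨p, hk, rfl⟩
    let j := (e ⟨q k p, hq k p⟩ k (hkq k p)).symm y
    refine Nat.card_eq_one_iff_exists.2 ⟨⟨(⟨q k p, hq k p⟩, j), hkq k p, ?_⟩, ?_⟩
    · rw [ha _ _ (hkq k p)]
      exact congrArg Subtype.val ((e ⟨q k p, hq k p⟩ k (hkq k p)).apply_symm_apply y)
    · rintro ⟨⟨⟨s, hs⟩, i⟩, hks, hp⟩
      rw [ha _ _ hks] at hp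
      dsimp only at hp
      obtain rfl : q k p = s := by
        rw [← hp]
        exact (e ⟨s, hs⟩ k hks i).2.2
      refine Subtype.ext (Prod.ext rfl ?_)
      exact ((e ⟨q k p, hs⟩ k hks).symm_apply_apply i).symm.trans
        (congrArg _ (Subtype.ext hp))
  · let f : {p : P // k ∈ T p} ≃ Σ s : {s : Finset (Fin n) // s.card = 2 * τ ∧ k ∈ s},
        {i // i ∈ s.1 ∧ k ∈ N ⟨s.1, s.2.1⟩ i} :=
      { toFun := fun p => ⟨⟨p.1.1.1, p.1.2.1, (hT p.1).1 p.2⟩, p.1.1.2, p.1.2.2, p.2⟩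
        invFun := fun y => ⟨⟨(y.1.1, y.2.1), y.1.2.1, y.2.2.1⟩, y.2.2.2⟩
        left_inv := fun _ => rfl
        right_inv := fun _ => rfl }
    rw [Nat.card_congr f, Nat.card_sigma, ← card_finset_mem n (2 * τ) k,
      Finset.sum_congr rfl fun (s : {s : Finset (Fin n) // s.card = 2 * τ ∧ k ∈ s}) _ =>
        hN' ⟨s.1, s.2.1⟩ k s.2.2]
    simp

/-! ### The entries of the table -/

theorem beta_mul_self (m : ℕ) (hm : 0 < m) : beta (m * 1) m = 1 := by
  have : (m : ℚ) ≠ 0 := by positivity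
  simp [beta, sgn, this, hm]

/-- Since `m` divides `t - m`, the factor `l` is 1, leaving `(τ + 1) + (τ - 1)`. This is the
multiplicity of the subset design. -/
theorem beta_mul (m τ : ℕ) (hm : 0 < m) (hτ : 1 < τ) : beta (m * τ) m = 2 * τ := by
  have h0 : (m : ℚ) ≠ 0 := by positivity
  have h1 : (m : ℚ) / (m * τ : ℕ) ≠ 1 := by
    rw [Nat.cast_mul, Ne, div_eq_one_iff_eq (by positivity)]
    intro h
    have : (τ : ℚ) = 1 := by
      have := mul_left_cancel₀ h0 ((mul_one _).trans h)
      exact this.symm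
    norm_cast at this
    omega
  have h2 : m * τ - m = m * (τ - 1) := by rw [Nat.mul_sub, mul_one]
  unfold beta sgn
  rw [if_neg h1, h2, Nat.mul_div_cancel_left _ hm, Nat.mul_div_cancel_left _ hm,
    Nat.gcd_mul_right_right, Nat.div_self hm]
  omega

theorem Listed.two_mul_le {K t F : ℕ} (h : Listed K t F) : 2 * t ≤ K := by
  cases h <;> omega

theorem Listed.hasDesign {K t F : ℕ} (h : Listed K t F) (ht : 0 < t) :
    0 < F ∧ HasDesign K t F := by
  obtain ⟨m, hm, ⟨n, rfl⟩, ⟨τ, rfl⟩, -, htK⟩ | htK | htK := h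
  · have hτ : 0 < τ := Nat.pos_of_mul_pos_left ht
    have hn : 2 * τ ≤ n := by
      by_contra hlt
      have := Nat.mul_le_mul_left m (show n ≤ 2 * τ by omega)
      rw [Nat.mul_left_comm] at this
      omega
    rw [Nat.mul_div_cancel_left _ hm, Nat.mul_div_cancel_left _ hm]
    obtain rfl | hτ1 : τ = 1 ∨ 1 < τ := by omega
    · rw [beta_mul_self m hm, Nat.choose_one_right]
      obtain ⟨δ⟩ := nonempty_design_pairs n
      refine ⟨by omega, ?_⟩
      simpa [mul_comm] using δ.hasDesign one_pos m
    · rw [beta_mul m τ hm hτ1]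
      obtain ⟨δ⟩ := nonempty_design_subsets n τ hτ hn
      refine ⟨Nat.mul_pos (by omega) (Nat.choose_pos (by omega)), ?_⟩
      simpa [mul_comm] using δ.hasDesign (by omega) m
  · have hα : 0 < K.gcd t := Nat.gcd_pos_of_pos_right _ ht
    obtain ⟨n, hn⟩ := Nat.gcd_dvd_left K t
    obtain ⟨τ, hτ⟩ := Nat.gcd_dvd_right K t
    set α := K.gcd t
    have hτ0 : 0 < τ := Nat.pos_of_ne_zero (by rintro rfl; omega)
    have hle : 2 * τ ≤ n := by
      refine Nat.le_of_mul_le_mul_left ?_ hα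
      rwa [← hn, Nat.mul_left_comm, ← hτ]
    have h1 : K / α = n := Nat.div_eq_of_eq_mul_right hα hn
    have h2 : 2 * t / α = 2 * τ := Nat.div_eq_of_eq_mul_right hα (by rw [hτ]; ring)
    rw [h1, h2]
    obtain ⟨δ⟩ := nonempty_design_pointed n τ hτ0 hle
    refine ⟨Nat.mul_pos (by omega) (Nat.choose_pos hle), ?_⟩
    have := δ.hasDesign one_pos α
    rwa [Fintype.card_fin, card_pointed_finset, mul_one, mul_comm n, mul_comm τ, ← hn, ← hτ] at this
  -- Two users and two packets form the seed. Repeating the groups `t` times and then splitting the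
  -- packets yields `2 * t` packets, and each user is replaced by `t` users.
  · obtain ⟨δ⟩ := nonempty_design_pointed 2 1 one_pos le_rfl
    have := (δ.replicate t).hasDesign (by omega) t
    rw [Fintype.card_fin, card_pointed_finset] at this
    refine ⟨by omega, ?_⟩
    simpa [htK] using this

/-! ### Normalized delivery time -/

theorem isNDT_of_mul_eq {S F : ℕ} (hF : 0 < F) {τ : ℝ} (h : τ * F = S) : IsNDT S F τ := by
  intro rate b hrate hb
  have hF' : (F : ℝ) ≠ 0 := by positivity
  have hlog : ∀ᶠ P in atTop, (0 : ℝ) < Real.log P := Real.tendsto_log_atTop.eventually_gt_atTop 0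
  have hequiv : rate ~[atTop] Real.log := hrate
  have hratio : Tendsto (fun P => rate P / Real.log P) atTop (𝓝 1) :=
    (isEquivalent_iff_tendsto_one (hlog.mono fun _ h => h.ne')).1 hequiv
  -- With `S = τ * F`, the normalized time is `τ * log P` divided by the bits per slot, which tend
  -- to `rate P` as `V → ∞`.
  refine ⟨fun P => τ * (rate P / Real.log P)⁻¹, ?_, ?_⟩
  · filter_upwards [hb, hlog, hratio.eventually (eventually_gt_nhds one_pos)] with P hP hl hr
    have hr' : rate P ≠ 0 := fun h0 => by simp [h0] at hr
    have := (hP.inv₀ hr').const_mul (τ * Real.log P)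
    refine (this.congr' ?_).trans (by rw [inv_div]; apply le_of_eq; congr 1; ring)
    filter_upwards [eventually_gt_atTop 0] with V hV
    rw [← h]
    by_cases hbz : (b P V : ℝ) = 0
    · simp [hbz]
    · field_simp
  · simpa using (hratio.inv₀ one_ne_zero).const_mul τ

/-! ### Beamforming and decoding -/

/-- The `L × L` diagonal projection onto the first `t` antennas. -/
def antennaProj (L t : ℕ) : Matrix (Fin L) (Fin L) ℂ :=
  diagonal fun l => if (l : ℕ) < t then 1 else 0

/-- With senders `T`, receivers `Q` and `t` active antennas, the channel is a product `B * A` of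
nonsingular `t × t` matrices, so any values can be prescribed on `Q`. -/
theorem exists_beam {K L t : ℕ} (htL : t ≤ L) {H : Matrix (Fin L) (Fin K) ℂ}
    {D : Matrix (Fin K) (Fin L) ℂ} (hH : SubmatricesFullRank H) (hD : SubmatricesFullRank D)
    {T Q : Finset (Fin K)} (hT : T.card = t) (hQ : Q.card = t) (k : Fin K) :
    ∃ x : Fin K → ℂ, (∀ j ∉ T, x j = 0) ∧
      ∀ k' ∈ Q, ((D * (antennaProj L t * H)) *ᵥ x) k' = if k' = k then 1 else 0 := by
  classical
  let c : Fin t ↪ Fin L := Fin.castLEEmb htL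
  let iT : Fin t ↪ Fin K := (T.orderEmbOfFin hT).toEmbedding
  let iQ : Fin t ↪ Fin K := (Q.orderEmbOfFin hQ).toEmbedding
  have h1 := hH t c iT
  have h2 := hD t iQ c
  set A := H.submatrix c iT
  set B := D.submatrix iQ c
  have h3 : IsUnit (B * A) := by
    rw [Matrix.isUnit_iff_isUnit_det, det_mul]
    exact (mul_ne_zero h2 h1).isUnit
  obtain ⟨y, hy⟩ := Matrix.mulVec_surjective_iff_isUnit.2 h3 (fun i => if iQ i = k then 1 else 0)
  refine ⟨fun j => ∑ i, if iT i = j then y i else 0, fun j hj => ?_, fun k' hk' => ?_⟩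
  · refine Finset.sum_eq_zero fun i _ => if_neg ?_
    rintro rfl
    exact hj (T.orderEmbOfFin_mem hT i)
  · obtain ⟨q, rfl⟩ : k' ∈ Set.range iQ := by
      have := Finset.range_orderEmbOfFin Q hQ
      exact this.symm ▸ hk'
    have hsum : ∀ f : Fin L → ℂ, ∑ l : Fin L, (if (l : ℕ) < t then f l else 0) = ∑ i, f (c i) := by
      intro f
      rw [← Finset.sum_filter, ← Finset.sum_map univ c f]
      congr 1
      ext l
      simp only [mem_filter, mem_univ, true_and, Finset.mem_map]
      exact ⟨fun h => ⟨⟨l, h⟩, rfl⟩, by rintro ⟨i, rfl⟩; exact i.2⟩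
    have hBA : ∀ i, (D * (antennaProj L t * H)) (iQ q) (iT i) = (B * A) q i := by
      intro i
      simp only [antennaProj, Matrix.mul_apply (M := D), Matrix.mul_apply (M := B), diagonal_mul, A, B,
        submatrix_apply]
      rw [← hsum fun l => D (iQ q) l * H l (iT i)]
      exact Finset.sum_congr rfl fun l _ => by split_ifs <;> simp
    refine Eq.trans ?_ (congrFun hy q)
    simp only [mulVec, dotProduct, Finset.mul_sum]
    rw [Finset.sum_comm]
    refine Finset.sum_congr rfl fun i _ => ?_
    simp [← hBA]

/-- Reduces decodability to uniqueness: the observations need only determine the output. -/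
theorem exists_decoder {ι α β γ : Type*} [Nonempty γ] (A : ι → α) (B : ι → β) (C : ι → γ)
    (h : ∀ w w', A w = A w' → B w = B w' → C w = C w') :
    ∃ dec : α → β → γ, ∀ w, dec (A w) (B w) = C w := by
  classical
  refine ⟨fun a b => if hab : ∃ w, A w = a ∧ B w = b then C hab.choose
    else Classical.arbitrary γ, fun w => ?_⟩
  have hab : ∃ w', A w' = A w ∧ B w' = B w := ⟨w, rfl, rfl⟩
  refine (dif_pos hab).trans ?_
  exact h _ _ hab.choose_spec.1 hab.choose_spec.2

namespace DeliveryDesign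

variable {K L t F n : ℕ}

/-- The coefficients with which the users send the packet that group `s` delivers to user `j`:
only users that cache it transmit, and it reaches `j` but none of the other users of the group
that do not cache it. -/
theorem exists_beams (δ : DeliveryDesign (Fin K) (Fin F) (Fin n) t 1) (htL : t ≤ L)
    (c : Channel L K n n) :
    ∃ x : Fin n → Fin K → Fin K → ℂ, (∀ s j k, k ∉ δ.T (δ.a s j) → x s j k = 0) ∧
      (c.FullRank → ∀ s, ∀ j ∈ δ.S s, ∀ k ∈ δ.S s, k ∉ δ.T (δ.a s j) →
        ((c.down s * (antennaProj L t * c.up s)) *ᵥ x s j) k = if k = j then 1 else 0) := by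
  classical
  have h : ∀ s j, ∃ x : Fin K → ℂ, (∀ k, k ∉ δ.T (δ.a s j) → x k = 0) ∧
      (c.FullRank → j ∈ δ.S s → ∀ k ∈ δ.S s, k ∉ δ.T (δ.a s j) →
        ((c.down s * (antennaProj L t * c.up s)) *ᵥ x) k = if k = j then 1 else 0) := by
    intro s j
    by_cases hc : c.FullRank ∧ j ∈ δ.S s
    · obtain ⟨x, hx, hx'⟩ := exists_beam htL (hc.1.1 s) (hc.1.2 s) (δ.card_T (δ.a s j))
        (Q := δ.S s \ δ.T (δ.a s j)) (by
          rw [Finset.card_sdiff_of_subset (δ.subset s j hc.2), δ.card_S, δ.card_T]; omega) j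
      exact ⟨x, hx, fun _ _ k hk hk' => hx' k (Finset.mem_sdiff.2 ⟨hk, hk'⟩)⟩
    · exact ⟨0, fun _ _ => rfl, fun h1 h2 => absurd ⟨h1, h2⟩ hc⟩
  choose x hx hx' using h
  exact ⟨x, hx, fun hc s j hj => hx' s j hc hj⟩

/-- The beamforming coefficients of `exists_beams`. -/
def beam (δ : DeliveryDesign (Fin K) (Fin F) (Fin n) t 1) (htL : t ≤ L) (c : Channel L K n n) :
    Fin n → Fin K → Fin K → ℂ :=
  (δ.exists_beams htL c).choose

open Classical in
/-- The uplink precoding matrices: the superposition of the beams of all users of the group. -/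
def uplink (δ : DeliveryDesign (Fin K) (Fin F) (Fin n) t 1) (htL : t ≤ L) {N : ℕ}
    (d : Fin K → Fin N) (c : Channel L K n n) (s : Fin n) : Matrix (Fin K) (Fin N × Fin F) ℂ :=
  Matrix.of fun k p => ∑ j ∈ δ.S s, if (d j, δ.a s j) = p then δ.beam htL c s j k else 0

/-- The downlink precoding matrices: in transmission `s` the first `t` antennas repeat what they
received in the uplink transmission `s`. -/
def relay (L t n : ℕ) (s : Fin n) : Matrix (Fin L) (Fin n × Fin L) ℂ :=
  Matrix.of fun l i => if i.1 = s then antennaProj L t l i.2 else 0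

theorem userSignal_relay {L K b n : ℕ} (D : Matrix (Fin K) (Fin L) ℂ) (s : Fin n)
    (Y : Matrix (Fin n × Fin L) (Fin b) ℂ) :
    userSignal D (relay L t n s) Y
      = D * (antennaProj L t * Matrix.of fun l => Y (s, l)) := by
  unfold userSignal
  congr 1
  ext l i
  simp [relay, Matrix.mul_apply, Fintype.sum_prod_type]

theorem userSignal_uplink (δ : DeliveryDesign (Fin K) (Fin F) (Fin n) t 1) (htL : t ≤ L) {N b : ℕ}
    (d : Fin K → Fin N) (c : Channel L K n n) (W : Matrix (Fin N × Fin F) (Fin b) ℂ) (s : Fin n)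
    (k : Fin K) :
    userSignal (c.down s) (relay L t n s) (bsStack c.up (δ.uplink htL d c) W) k
      = ∑ j ∈ δ.S s, ((c.down s * (antennaProj L t * c.up s)) *ᵥ δ.beam htL c s j) k •
          W (d j, δ.a s j) := by
  classical
  rw [userSignal_relay]
  have h : (Matrix.of fun l => bsStack c.up (δ.uplink htL d c) W (s, l))
      = c.up s * (δ.uplink htL d c s * W) := rfl
  have h2 : δ.uplink htL d c s * W
      = Matrix.of fun k i => ∑ j ∈ δ.S s, δ.beam htL c s j k * W (d j, δ.a s j) i := by
    ext k i
    simp [uplink, Matrix.mul_apply, Finset.sum_mul, ite_mul]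
    rw [Finset.sum_comm]
    simp
  rw [h, ← Matrix.mul_assoc, ← Matrix.mul_assoc, ← Matrix.mul_assoc (c.down s), h2]
  ext i
  simp [Matrix.mul_apply (N := Matrix.of _), mulVec, dotProduct, Finset.mul_sum, Finset.sum_apply,
    Finset.sum_mul]
  rw [Finset.sum_comm]
  simp [mul_assoc]

/-- In the group that serves `f` to `k`, each interfering packet is either cached by `k` or nulled
at `k`, and the desired one arrives with coefficient 1. -/
theorem decodes (δ : DeliveryDesign (Fin K) (Fin F) (Fin n) t 1) (htL : t ≤ L) {N b : ℕ}
    (d : Fin K → Fin N) (c : Channel L K n n) (hc : c.FullRank) (k : Fin K)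
    (W W' : Matrix (Fin N × Fin F) (Fin b) ℂ)
    (hcache : ∀ m f, k ∈ δ.T f → W (m, f) = W' (m, f))
    (hrec : ∀ s, userSignal (c.down s) (relay L t n s) (bsStack c.up (δ.uplink htL d c) W) k
      = userSignal (c.down s) (relay L t n s) (bsStack c.up (δ.uplink htL d c) W') k) (f : Fin F) :
    W (d k, f) = W' (d k, f) := by
  by_cases hk : k ∈ δ.T f
  · exact hcache _ _ hk
  obtain ⟨s, hs, rfl⟩ : ∃ s, k ∈ δ.S s ∧ δ.a s k = f := by
    have := δ.served k f hk
    obtain ⟨⟨s, hs⟩⟩ := (Nat.card_pos_iff.1 (this ▸ one_pos)).1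
    exact ⟨s, hs⟩
  have hx := (δ.exists_beams htL c).choose_spec.2 hc s
  have h := hrec s
  rw [δ.userSignal_uplink, δ.userSignal_uplink, ← Finset.add_sum_erase _ _ hs,
    ← Finset.add_sum_erase _ _ hs] at h
  have hrest : ∀ j ∈ (δ.S s).erase k,
      ((c.down s * (antennaProj L t * c.up s)) *ᵥ δ.beam htL c s j) k • W (d j, δ.a s j)
      = ((c.down s * (antennaProj L t * c.up s)) *ᵥ δ.beam htL c s j) k • W' (d j, δ.a s j) := by
    intro j hj
    by_cases hkj : k ∈ δ.T (δ.a s j)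
    · rw [hcache _ _ hkj]
    · have := hx j (Finset.mem_of_mem_erase hj) k hs hkj
      rw [if_neg (Finset.ne_of_mem_erase hj).symm] at this
      unfold beam
      rw [this, zero_smul, zero_smul]
  rw [Finset.sum_congr rfl hrest] at h
  have h1 := hx k hs k hs hk
  rw [if_pos rfl] at h1
  have h2 := add_right_cancel h
  unfold beam at h2
  rwa [h1, one_smul, one_smul] at h2

/-- The packets that the users cache: those of which they cache a copy in the design, for every
file. -/
def cache (δ : DeliveryDesign (Fin K) (Fin F) (Fin n) t 1) (N : ℕ) (k : Fin K) :
    Finset (Fin N × Fin F) :=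
  univ ×ˢ univ.filter fun f => k ∈ δ.T f

theorem card_filter_mem (δ : DeliveryDesign (Fin K) (Fin F) (Fin n) t 1) (k : Fin K) :
    (univ.filter fun f => k ∈ δ.T f).card = δ.z := by
  rw [← δ.regular k, Nat.card_eq_fintype_card, Fintype.card_subtype]

/-- The coded caching scheme given by a delivery design. -/
def scheme (δ : DeliveryDesign (Fin K) (Fin F) (Fin n) t 1) (htL : t ≤ L) (hF : 0 < F) (N : ℕ) :
    Scheme L K ((δ.z : ℝ) * N / F) N F where
  cache := δ.cache N
  cache_card_le k := by
    have : (F : ℝ) ≠ 0 := by positivity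
    simp only [cache, Finset.card_product, δ.card_filter_mem, Finset.card_univ, Fintype.card_fin]
    rw [div_mul_cancel₀ _ this]
    push_cast
    rw [mul_comm]
  SUL := n
  SDL := n
  V := δ.uplink htL
  V_support d c s k p h := by
    classical
    obtain ⟨j, -, hj⟩ := Finset.exists_ne_zero_of_sum_ne_zero h
    obtain ⟨rfl, hj⟩ := ite_ne_right_iff.1 hj
    refine ⟨?_, j, rfl⟩
    simp only [cache, mem_product, mem_univ, mem_filter, true_and]
    by_contra hk
    refine hj ((if_pos rfl).trans ?_)
    exact (δ.exists_beams htL c).choose_spec.1 s j k hk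
  U _ _ := relay L t n
  decodable d c hc b k := by
    refine exists_decoder (fun W (p : δ.cache N k) => W p)
      (fun W s' => userSignal (c.down s') (relay L t n s') (bsStack c.up (δ.uplink htL d c) W) k)
      (fun W f => W (d k, f)) fun W W' h1 h2 => funext fun f => ?_
    refine δ.decodes htL d c hc k W W' (fun m f hf => ?_) (fun s => congrFun h2 s) f
    exact congrFun h1 ⟨(m, f), by simp [cache, hf]⟩

end DeliveryDesign
open DeliveryDesign

/-! ### From designs to sum-DoF and delivery times -/

theorem HasDesign.exists_scheme {K L t F : ℕ} (h : HasDesign K t F) (hF : 0 < F) (hK : 2 * t ≤ K)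
    (ht : 0 < t) (htL : t ≤ L) (N : ℕ) :
    ∃ Z : ℕ, K * Z = t * F ∧
      ∃ σ : Scheme L K ((Z : ℝ) * N / F) N F,
        (∀ (k : Fin K) (n : Fin N),
          (Finset.univ.filter fun f : Fin F => (n, f) ∈ σ.cache k).card = Z) ∧
        (∃ A : Finset (Fin L), A.card = t ∧ σ.UsesOnlyAntennas A) ∧
        (∀ d : Fin K → Fin N, σ.sumDoFUL d = 2 * t ∧ σ.sumDoFDL d = 2 * t) ∧
        IsNDT σ.SUL F (((K : ℝ) - t) / (2 * t)) ∧
        IsNDT σ.SDL F (((K : ℝ) - t) / (2 * t)) := by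
  obtain ⟨n, ⟨δ⟩⟩ := h
  have h1 := δ.card_user_mul
  have h2 := δ.card_group_mul
  simp only [Fintype.card_fin, mul_one] at h1 h2
  have hn : (2 : ℝ) * t * n = F * (K - t) := by
    rw [← Nat.cast_sub (by omega)]; exact_mod_cast h2
  have ht0 : (t : ℝ) ≠ 0 := by positivity
  have hn0 : (n : ℝ) ≠ 0 := by
    rintro h0
    have : (n : ℕ) = 0 := by exact_mod_cast h0
    rw [this, mul_zero] at h2
    have : 0 < F * (K - t) := Nat.mul_pos hF (by omega)
    omega
  have hcard : ∀ (k : Fin K) (m : Fin N), (Finset.univ.filter fun f : Fin F =>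
      (m, f) ∈ (δ.scheme htL hF N).cache k).card = δ.z := by
    intro k m
    simp [scheme, cache, δ.card_filter_mem]
  have hdof : ∀ d : Fin K → Fin N,
      ((δ.scheme htL hF N).requiredPackets d : ℝ) / n = 2 * t := by
    intro d
    have h3 : ∀ k, (Finset.univ.filter fun f : Fin F =>
        (d k, f) ∉ (δ.scheme htL hF N).cache k).card + δ.z = F := by
      intro k
      have := Finset.card_filter_add_card_filter_not (s := (univ : Finset (Fin F)))
        fun f => (d k, f) ∈ (δ.scheme htL hF N).cache k
      rw [hcard k (d k), Finset.card_univ, Fintype.card_fin] at this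
      omega
    -- Every user caches `z` packets of its file whatever the demand, so with `K * z = t * F` the
    -- required packets number `F * (K - t)`, which is `2 * t * n`.
    have h4 : (δ.scheme htL hF N).requiredPackets d + K * δ.z = K * F := by
      have := Finset.sum_congr rfl fun k (_ : k ∈ univ) => h3 k
      rw [Finset.sum_add_distrib] at this
      simpa [Scheme.requiredPackets] using this
    rw [div_eq_iff hn0, hn]
    have h5 : ((δ.scheme htL hF N).requiredPackets d : ℝ) + K * δ.z = K * F := by exact_mod_cast h4
    have h6 : (K : ℝ) * δ.z = t * F := by exact_mod_cast h1
    linarith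
  have hndt : IsNDT n F (((K : ℝ) - t) / (2 * t)) := isNDT_of_mul_eq hF (by
    field_simp
    linarith)
  refine ⟨δ.z, h1, δ.scheme htL hF N, hcard, ⟨univ.filter fun l => (l : ℕ) < t, ?_, ?_⟩,
    fun d => ⟨hdof d, hdof d⟩, hndt, hndt⟩
  · rw [Fin.card_filter_val_lt]
    omega
  · intro d c s' l s j hlj
    simp only [mem_filter, mem_univ, true_and] at hlj
    simp only [scheme, relay, antennaProj, of_apply, diagonal_apply]
    split_ifs <;> first | rfl | (subst_vars; omega)

end MIR

end

theorem theorem3 (K L t : ℕ) (hK : 0 < K) (hL : 0 < L) (ht : 0 < t) (htL : t < L)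
    (N : ℕ) (hN : 0 < N) (F : ℕ) (hF : MIR.Listed K t F) :
    0 < F ∧
    ∃ Z : ℕ, K * Z = t * F ∧
      ∃ σ : MIR.Scheme L K ((Z : ℝ) * N / F) N F,
        (∀ (k : Fin K) (n : Fin N),
          (Finset.univ.filter fun f : Fin F => (n, f) ∈ σ.cache k).card = Z) ∧
        (∃ A : Finset (Fin L), A.card = t ∧ σ.UsesOnlyAntennas A) ∧
        (∀ d : Fin K → Fin N, σ.sumDoFUL d = 2 * t ∧ σ.sumDoFDL d = 2 * t) ∧
        MIR.IsNDT σ.SUL F (((K : ℝ) - t) / (2 * t)) ∧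
        MIR.IsNDT σ.SDL F (((K : ℝ) - t) / (2 * t)) := by
  obtain ⟨hF0, hdes⟩ := hF.hasDesign ht
  exact ⟨hF0, hdes.exists_scheme hF0 hF.two_mul_le ht htL.le N⟩
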